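/- There is an absolute constant $\Delta_0$ such that for every real $\alpha>16$ there exists $\beta=\beta(\alpha)>0$, depending only on $\alpha$, with the following property. Let $G=(V,E)$ be a finite simple graph with maximum degree $\Delta\ge\Delta_0$ and minimum degree $\delta\ge\log^2\Delta=(\ln\Delta)^2$. Then there exist an integer $\ell\le\lceil 2\sqrt{2\lceil\alpha\Delta\rceil}\rceil$ and pairwise edge-disjoint spanning subgraphs $G_1,\dots,G_\ell$ of $G$ (each with vertex set $V$), none of which contains the $4$-cycle $C_4$ as a (not necessarily induced) subgraph, such that for every $v\in V$ \[ \sum_{i=1}^{\ell} d_{G_i}(v)\ \ge\ \beta\, d_G(v). \] -/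

import Mathlib

open scoped Classical

open Finset

/-! Colour the vertices by points of `ZMod q × ZMod q`, and suppose that a subgraph `H` of `G` has
distinctly coloured neighbours at every vertex. Sort the edges of `H` by the value of `a c - b - d`.
Within one class the neighbours of a vertex lie on a line of the plane, and distinct such lines meet
at most once, so no `C_4` survives (`planeClass_free`). Bertrand's postulate supplies a prime `q`
that is small enough, with `q ^ 2 > 32 Δ`.

It remains to find a colouring for which `H = mutualGraph G f` keeps half of each degree. Each
vertex accepts at most one edge per colour, towards the neighbour of strictly least degree. The loss
at `v` is bounded by a weight on monochromatic pairs (`card_rejected_le`) whose totals, per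
constraint and per vertex, are `O(Δ)`. The local lemma `exists_coloring_monoWeight_lt_one` then
applies: adding a vertex or a constraint at most halves the penalised count, which therefore stays
positive. -/

/-- Resampling one coordinate of a uniformly random function leaves its distribution unchanged. -/
lemma sum_sum_update {V C : Type*} [Fintype V] [Fintype C] (x : V) (h : (V → C) → ℝ) :
    ∑ f : V → C, ∑ c : C, h (Function.update f x c) = Fintype.card C * ∑ f, h f := by
  have key : ∑ p : (V → C) × C, h (Function.update p.1 x p.2) = ∑ p : (V → C) × C, h p.1 := by
    -- Swapping the fresh colour with the old one at `x` is an involution.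
    refine Finset.sum_nbij' (fun p => (Function.update p.1 x p.2, p.1 x))
      (fun p => (Function.update p.1 x p.2, p.1 x)) ?_ ?_ ?_ ?_ ?_ <;> simp
  rw [Fintype.sum_prod_type, Fintype.sum_prod_type] at key
  rw [key]
  simp [Finset.mul_sum]

lemma card_mul_sum_ite_eq {V C : Type*} [Fintype V] [Fintype C] {x y : V} (hxy : x ≠ y)
    (g : (V → C) → ℝ) (hg : ∀ f c, g (Function.update f x c) = g f) :
    (Fintype.card C : ℝ) * ∑ f : V → C, (if f x = f y then g f else 0) = ∑ f, g f := by
  rw [← sum_sum_update x]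
  refine Finset.sum_congr rfl fun f _ => ?_
  simp [hg, Function.update_of_ne hxy.symm]

lemma prod_sub_prod_le {ι : Type*} (s : Finset ι) (p r : ι → ℝ) (hr : ∀ i, 0 ≤ r i)
    (hrp : ∀ i, r i ≤ p i) :
    ∏ i ∈ s, p i - ∏ i ∈ s, r i ≤ ∑ i ∈ s, (p i - r i) * ∏ j ∈ s.erase i, p j := by
  induction s using Finset.induction_on with
  | empty => simp
  | insert k s hk ih =>
    have hpn : ∀ i, 0 ≤ p i := fun i => (hr i).trans (hrp i)
    rw [Finset.prod_insert hk, Finset.prod_insert hk, Finset.sum_insert hk,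
      Finset.erase_insert hk]
    have h1 : ∑ i ∈ s, (p i - r i) * ∏ j ∈ (insert k s).erase i, p j
        = p k * ∑ i ∈ s, (p i - r i) * ∏ j ∈ s.erase i, p j := by
      rw [Finset.mul_sum]
      refine Finset.sum_congr rfl fun i hi => ?_
      have hki : k ≠ i := fun h => hk (h ▸ hi)
      rw [Finset.erase_insert_of_ne hki, Finset.prod_insert (by simp [hk])]
      ring
    rw [h1]
    have h2 := mul_le_mul_of_nonneg_left ih (hpn k)
    have h3 : ∏ i ∈ s, r i ≤ ∏ i ∈ s, p i :=
      Finset.prod_le_prod (fun i _ => hr i) (fun i _ => hrp i)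
    have h4 := mul_le_mul_of_nonneg_left h3 (sub_nonneg.2 (hrp k))
    nlinarith

/-! ### A local lemma with linear penalties -/

section SoftLocalLemma

variable {V C I : Type*}

/-- Total weight under `a` of the monochromatic ordered pairs of distinct elements of `S`. -/
noncomputable def monoWeight (a : V → V → ℝ) (S : Finset V) (f : V → C) : ℝ :=
  ∑ x ∈ S, ∑ y ∈ S, if x ≠ y ∧ f x = f y then a x y else 0

/-- The penalised number of colourings: each constraint in `P` is weighted by its slack. -/
noncomputable def penalisedCount [Fintype V] [Fintype C] (a : I → V → V → ℝ) (S : Finset V)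
    (P : Finset I) : ℝ :=
  ∑ f : V → C, ∏ i ∈ P, max 0 (1 - monoWeight (a i) S f)

lemma monoWeight_mono {a : V → V → ℝ} (ha : ∀ x y, 0 ≤ a x y) {S T : Finset V} (h : S ⊆ T)
    (f : V → C) : monoWeight a S f ≤ monoWeight a T f := by
  have h0 : ∀ x y, 0 ≤ (if x ≠ y ∧ f x = f y then a x y else 0) := fun x y => by
    split_ifs
    exacts [ha x y, le_rfl]
  refine (Finset.sum_le_sum_of_subset_of_nonneg h fun x _ _ =>
    Finset.sum_nonneg fun y _ => h0 x y).trans ?_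
  exact Finset.sum_le_sum fun x _ =>
    Finset.sum_le_sum_of_subset_of_nonneg h fun y _ _ => h0 x y

lemma monoWeight_update (a : V → V → ℝ) {S : Finset V} {x : V} (hx : x ∉ S) (f : V → C) (c : C) :
    monoWeight a S (Function.update f x c) = monoWeight a S f := by
  refine Finset.sum_congr rfl fun y hy => Finset.sum_congr rfl fun z hz => ?_
  have hyx : y ≠ x := ne_of_mem_of_not_mem hy hx
  have hzx : z ≠ x := ne_of_mem_of_not_mem hz hx
  rw [Function.update_of_ne hyx, Function.update_of_ne hzx]

lemma monoWeight_insert (a : V → V → ℝ) {S : Finset V} {x : V} (hx : x ∉ S) (f : V → C) :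
    monoWeight a (insert x S) f =
      monoWeight a S f + ∑ y ∈ S, if f x = f y then a x y + a y x else 0 := by
  unfold monoWeight
  rw [Finset.sum_insert hx, Finset.sum_insert hx]
  simp only [ne_eq, not_true_eq_false, false_and, if_false, zero_add]
  have h : ∑ z ∈ S, ∑ y ∈ insert x S, (if ¬z = y ∧ f z = f y then a z y else 0) =
      ∑ z ∈ S, (if f x = f z then a z x else 0) +
        ∑ z ∈ S, ∑ y ∈ S, (if ¬z = y ∧ f z = f y then a z y else 0) := by
    rw [← Finset.sum_add_distrib]
    refine Finset.sum_congr rfl fun z hz => ?_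
    rw [Finset.sum_insert hx]
    have : z ≠ x := fun h => hx (h ▸ hz)
    simp [this, eq_comm]
  rw [h, ← add_assoc, ← Finset.sum_add_distrib, add_comm]
  congr 1
  refine Finset.sum_congr rfl fun z hz => ?_
  have : x ≠ z := fun h => hx (h ▸ hz)
  by_cases hc : f x = f z <;> simp [this, hc]

variable [Fintype V] [Fintype C] {a : I → V → V → ℝ}

lemma penalisedCount_nonneg (S : Finset V) (P : Finset I) :
    0 ≤ penalisedCount (C := C) a S P :=
  Finset.sum_nonneg fun _ _ => Finset.prod_nonneg fun _ _ => le_max_left _ _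

/-- Removing `x` from `S` only raises the product and makes it independent of `f x`, which then
agrees with `f y` with probability `1 / |C|`. -/
lemma card_mul_sum_mono_le (ha : ∀ i x y, 0 ≤ a i x y) {S : Finset V} (P : Finset I) {x y : V}
    (hxy : x ≠ y) :
    (Fintype.card C : ℝ) * ∑ f : V → C,
      (if f x = f y then ∏ i ∈ P, max 0 (1 - monoWeight (a i) S f) else 0) ≤
      penalisedCount (C := C) a (S.erase x) P := by
  rw [penalisedCount, ← card_mul_sum_ite_eq hxy
    (fun f : V → C => ∏ i ∈ P, max 0 (1 - monoWeight (a i) (S.erase x) f))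
    (fun f c => by simp only [monoWeight_update _ (Finset.notMem_erase x S)])]
  refine mul_le_mul_of_nonneg_left (Finset.sum_le_sum fun f _ => ?_) (Nat.cast_nonneg _)
  split_ifs
  · refine Finset.prod_le_prod (fun _ _ => le_max_left _ _) fun i _ => ?_
    exact max_le_max le_rfl (by linarith [monoWeight_mono (ha i) (Finset.erase_subset x S) f])
  · exact le_rfl

/-- Since `1 - max 0 (1 - t) ≤ t`, the loss is linear in the weight and can be bounded pair by pair.
-/
lemma penalisedCount_sub_insert_constraint (ha : ∀ i x y, 0 ≤ a i x y) (S : Finset V)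
    {P : Finset I} {i : I} (hi : i ∉ P) :
    (Fintype.card C : ℝ) *
      (penalisedCount (C := C) a S P - penalisedCount (C := C) a S (insert i P)) ≤
      ∑ x ∈ S, ∑ y ∈ S, a i x y * penalisedCount (C := C) a (S.erase x) P := by
  set g : (V → C) → ℝ := fun f => ∏ j ∈ P, max 0 (1 - monoWeight (a j) S f) with hg
  have hg0 : ∀ f, 0 ≤ g f := fun f => Finset.prod_nonneg fun _ _ => le_max_left _ _
  have h1 : penalisedCount (C := C) a S P - penalisedCount (C := C) a S (insert i P) ≤
      ∑ f, monoWeight (a i) S f * g f := by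
    rw [penalisedCount, penalisedCount, ← Finset.sum_sub_distrib]
    refine Finset.sum_le_sum fun f _ => ?_
    rw [Finset.prod_insert hi]
    have := mul_le_mul_of_nonneg_right (le_max_right 0 (1 - monoWeight (a i) S f)) (hg0 f)
    simp only [hg] at this ⊢
    linarith
  have h2 : ∑ f, monoWeight (a i) S f * g f = ∑ x ∈ S, ∑ y ∈ S,
      ∑ f : V → C, if x ≠ y ∧ f x = f y then a i x y * g f else 0 := by
    simp only [monoWeight, Finset.sum_mul, ite_mul, zero_mul]
    rw [Finset.sum_comm]
    exact Finset.sum_congr rfl fun x _ => Finset.sum_comm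
  refine (mul_le_mul_of_nonneg_left (h1.trans_eq h2) (Nat.cast_nonneg _)).trans ?_
  simp only [Finset.mul_sum]
  refine Finset.sum_le_sum fun x _ => Finset.sum_le_sum fun y _ => ?_
  by_cases hxy : x = y
  · simpa [hxy] using mul_nonneg (ha i y y) (penalisedCount_nonneg _ _)
  · have := mul_le_mul_of_nonneg_left (card_mul_sum_mono_le (C := C) ha (S := S) P hxy) (ha i x y)
    refine le_trans (le_of_eq ?_) this
    rw [← Finset.mul_sum, mul_left_comm, Finset.mul_sum Finset.univ _ (a i x y)]
    simp [hxy, hg]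

lemma penalisedCount_sub_insert_vertex (ha : ∀ i x y, 0 ≤ a i x y) {S : Finset V}
    (P : Finset I) {x : V} (hx : x ∉ S) :
    (Fintype.card C : ℝ) *
      (penalisedCount (C := C) a S P - penalisedCount (C := C) a (insert x S) P) ≤
      ∑ i ∈ P, ∑ y ∈ S, (a i x y + a i y x) * penalisedCount (C := C) a S (P.erase i) := by
  set g : I → (V → C) → ℝ := fun i f => ∏ j ∈ P.erase i, max 0 (1 - monoWeight (a j) S f) with hg
  have hg0 : ∀ i f, 0 ≤ g i f := fun i f => Finset.prod_nonneg fun _ _ => le_max_left _ _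
  have h1 : penalisedCount (C := C) a S P - penalisedCount (C := C) a (insert x S) P ≤
      ∑ f, ∑ i ∈ P, (∑ y ∈ S, if f x = f y then a i x y + a i y x else 0) * g i f := by
    rw [penalisedCount, penalisedCount, ← Finset.sum_sub_distrib]
    refine Finset.sum_le_sum fun f _ => ?_
    refine (prod_sub_prod_le P _ _ (fun _ => le_max_left _ _) fun i => ?_).trans
      (Finset.sum_le_sum fun i _ => mul_le_mul_of_nonneg_right ?_ (hg0 i f))
    · exact max_le_max le_rfl
        (by linarith [monoWeight_mono (ha i) (Finset.subset_insert x S) f])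
    · have h0 : 0 ≤ ∑ y ∈ S, if f x = f y then a i x y + a i y x else 0 :=
        Finset.sum_nonneg fun y _ => by
          split_ifs
          exacts [add_nonneg (ha i x y) (ha i y x), le_rfl]
      rw [monoWeight_insert (a i) hx f]
      rcases le_total (1 - monoWeight (a i) S f) 0 with h | h
      · rw [max_eq_left h, max_eq_left (by linarith)]
        linarith
      · rw [max_eq_right h]
        linarith [le_max_right 0 (1 - (monoWeight (a i) S f +
          ∑ y ∈ S, if f x = f y then a i x y + a i y x else 0))]
  have h2 : ∑ f : V → C, ∑ i ∈ P, (∑ y ∈ S, if f x = f y then a i x y + a i y x else 0) * g i f =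
      ∑ i ∈ P, ∑ y ∈ S, ∑ f : V → C, if f x = f y then (a i x y + a i y x) * g i f else 0 := by
    simp only [Finset.sum_mul, ite_mul, zero_mul]
    rw [Finset.sum_comm]
    exact Finset.sum_congr rfl fun i _ => Finset.sum_comm
  refine (mul_le_mul_of_nonneg_left (h1.trans_eq h2) (Nat.cast_nonneg _)).trans ?_
  simp only [Finset.mul_sum]
  refine Finset.sum_le_sum fun i _ => Finset.sum_le_sum fun y hy => ?_
  have hxy : x ≠ y := fun h => hx (h ▸ hy)
  have := mul_le_mul_of_nonneg_left
    (card_mul_sum_mono_le (C := C) ha (S := S) (P.erase i) hxy) (add_nonneg (ha i x y) (ha i y x))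
  rw [Finset.erase_eq_of_notMem hx] at this
  refine le_trans (le_of_eq ?_) this
  rw [← Finset.mul_sum, mul_left_comm, Finset.mul_sum Finset.univ _ (a i x y + a i y x)]
  simp [hg]

/-- A local lemma for weighted pair constraints: if every constraint has total weight at most
`|C| / 4` and every vertex lies in pairs of total weight at most `|C| / 4`, some colouring gives
monochromatic weight less than `1` in every constraint. -/
theorem exists_coloring_monoWeight_lt_one [Fintype I] [Nonempty C] (ha : ∀ i x y, 0 ≤ a i x y)
    (hrow : ∀ i, ∑ x, ∑ y, a i x y ≤ Fintype.card C / 4)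
    (hcol : ∀ x, ∑ i, ∑ y, (a i x y + a i y x) ≤ Fintype.card C / 4) :
    ∃ f : V → C, ∀ i, monoWeight (a i) univ f < 1 := by
  have hC : (0 : ℝ) < Fintype.card C := by exact_mod_cast Fintype.card_pos
  -- The two bounds feed each other: a new constraint is charged to deleting a vertex, a new vertex
  -- to deleting a constraint. The relative loss is at most `(1/4) * 2 = 1/2`.
  have step : ∀ n (S : Finset V) (P : Finset I), #S + #P = n →
      (∀ i ∉ P, penalisedCount (C := C) a S P ≤ 2 * penalisedCount (C := C) a S (insert i P)) ∧
      (∀ x ∉ S, penalisedCount (C := C) a S P ≤ 2 * penalisedCount (C := C) a (insert x S) P) := by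
    intro n
    induction n using Nat.strong_induction_on with
    | _ n ih =>
      intro S P hn
      have hF := penalisedCount_nonneg (C := C) (a := a) S P
      constructor
      · intro i hi
        have h := penalisedCount_sub_insert_constraint (C := C) ha S hi
        have hle : ∑ x ∈ S, ∑ y ∈ S, a i x y * penalisedCount (C := C) a (S.erase x) P ≤
            (Fintype.card C / 4) * (2 * penalisedCount (C := C) a S P) := by
          calc _ ≤ ∑ x ∈ S, ∑ y ∈ S, a i x y * (2 * penalisedCount (C := C) a S P) := by
                refine Finset.sum_le_sum fun x hx => Finset.sum_le_sum fun y _ =>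
                  mul_le_mul_of_nonneg_left ?_ (ha i x y)
                have hc := Finset.card_erase_add_one hx
                have := (ih _ (by omega) (S.erase x) P rfl).2 x (Finset.notMem_erase x S)
                rwa [Finset.insert_erase hx] at this
            _ = (∑ x ∈ S, ∑ y ∈ S, a i x y) * (2 * penalisedCount (C := C) a S P) := by
                simp only [Finset.sum_mul]
            _ ≤ _ := by
                refine mul_le_mul_of_nonneg_right (le_trans ?_ (hrow i)) (by linarith)
                refine (Finset.sum_le_sum fun x _ => Finset.sum_le_sum_of_subset_of_nonneg
                  (Finset.subset_univ S) fun y _ _ => ha i x y).trans ?_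
                exact Finset.sum_le_sum_of_subset_of_nonneg (Finset.subset_univ S)
                  fun x _ _ => Finset.sum_nonneg fun y _ => ha i x y
        have h' := h.trans hle
        have : (Fintype.card C : ℝ) * (penalisedCount (C := C) a S P) ≤
            Fintype.card C * (2 * penalisedCount (C := C) a S (insert i P)) := by linarith
        exact le_of_mul_le_mul_left this hC
      · intro x hx
        have h := penalisedCount_sub_insert_vertex (C := C) ha P hx
        have hle : ∑ i ∈ P, ∑ y ∈ S,
            (a i x y + a i y x) * penalisedCount (C := C) a S (P.erase i) ≤
            (Fintype.card C / 4) * (2 * penalisedCount (C := C) a S P) := by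
          have ha' : ∀ i y, 0 ≤ a i x y + a i y x := fun i y => add_nonneg (ha i x y) (ha i y x)
          calc _ ≤ ∑ i ∈ P, ∑ y ∈ S, (a i x y + a i y x) * (2 * penalisedCount (C := C) a S P) := by
                refine Finset.sum_le_sum fun i hi => Finset.sum_le_sum fun y _ =>
                  mul_le_mul_of_nonneg_left ?_ (ha' i y)
                have hc := Finset.card_erase_add_one hi
                have := (ih _ (by omega) S (P.erase i) rfl).1 i (Finset.notMem_erase i P)
                rwa [Finset.insert_erase hi] at this
            _ = (∑ i ∈ P, ∑ y ∈ S, (a i x y + a i y x)) *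
                  (2 * penalisedCount (C := C) a S P) := by
                simp only [Finset.sum_mul]
            _ ≤ _ := by
                refine mul_le_mul_of_nonneg_right (le_trans ?_ (hcol x)) (by linarith)
                refine (Finset.sum_le_sum fun i _ => Finset.sum_le_sum_of_subset_of_nonneg
                  (Finset.subset_univ S) fun y _ _ => ha' i y).trans ?_
                exact Finset.sum_le_sum_of_subset_of_nonneg (Finset.subset_univ P)
                  fun i _ _ => Finset.sum_nonneg fun y _ => ha' i y
        have h' := h.trans hle
        have : (Fintype.card C : ℝ) * (penalisedCount (C := C) a S P) ≤
            Fintype.card C * (2 * penalisedCount (C := C) a (insert x S) P) := by linarith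
        exact le_of_mul_le_mul_left this hC
  have hS : ∀ S : Finset V, 0 < penalisedCount (C := C) a S ∅ := fun S => by
    simpa [penalisedCount] using pow_pos hC _
  have hP : ∀ P : Finset I, 0 < penalisedCount (C := C) a univ P := by
    intro P
    induction P using Finset.induction_on with
    | empty => exact hS _
    | insert i P hi ih => linarith [(step _ univ P rfl).1 i hi]
  obtain ⟨f, -, hf⟩ := Finset.exists_ne_zero_of_sum_ne_zero (hP univ).ne'
  refine ⟨f, fun i => ?_⟩
  have h := Finset.prod_ne_zero_iff.1 hf i (Finset.mem_univ i)
  by_contra! hge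
  exact h (max_eq_left (by linarith))

end SoftLocalLemma

/-! ### Conflict weights and the choice of a colouring -/

section ConflictWeight

variable {V : Type*} [Fintype V] (G : SimpleGraph V) [DecidableRel G.Adj]

/-- The weight that vertex `v` gives to `x` and `y` receiving the same colour, either because
`x = v` and `y` competes with `v` at common neighbours, or because both are neighbours of `v`. -/
noncomputable def conflictWeight (v x y : V) : ℝ :=
  2 / (G.degree v : ℝ) *
    ((if x = v ∧ G.degree y ≤ G.degree v then
      ∑ u ∈ G.neighborFinset v, (if G.Adj u y then (1 : ℝ) else 0) else 0) +
    (if G.Adj v x ∧ G.Adj v y then 1 else 0))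

/-- At `u`, the edge to `v` is accepted if every other neighbour of `u` with the colour of `v` has
larger degree than `v`. -/
def Accepts {C : Type*} (f : V → C) (u v : V) : Prop :=
  ∀ w, G.Adj u w → w ≠ v → f w = f v → G.degree v < G.degree w

/-- The edges that are accepted at both ends. -/
def mutualGraph {C : Type*} (f : V → C) : SimpleGraph V where
  Adj u v := G.Adj u v ∧ Accepts G f u v ∧ Accepts G f v u
  symm := ⟨fun _ _ h => ⟨h.1.symm, h.2.2, h.2.1⟩⟩
  loopless := ⟨fun _ h => h.1.ne rfl⟩

lemma conflictWeight_nonneg (v x y : V) : 0 ≤ conflictWeight G v x y := by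
  unfold conflictWeight
  positivity

lemma sum_codegree_le (v : V) :
    ∑ y, ∑ u ∈ G.neighborFinset v, (if G.Adj u y then (1 : ℝ) else 0) ≤
      G.degree v * G.maxDegree := by
  rw [Finset.sum_comm]
  have h : ∀ u, ∑ y, (if G.Adj u y then (1 : ℝ) else 0) = G.degree u := fun u => by
    rw [Finset.sum_boole, ← G.card_neighborFinset_eq_degree, G.neighborFinset_eq_filter]
  simp only [h]
  calc ∑ u ∈ G.neighborFinset v, (G.degree u : ℝ)
      ≤ ∑ _u ∈ G.neighborFinset v, (G.maxDegree : ℝ) :=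
        Finset.sum_le_sum fun u _ => by exact_mod_cast G.degree_le_maxDegree u
    _ = _ := by simp

lemma codegree_comm (v y : V) :
    ∑ u ∈ G.neighborFinset v, (if G.Adj u y then (1 : ℝ) else 0) =
      ∑ u ∈ G.neighborFinset y, (if G.Adj u v then (1 : ℝ) else 0) := by
  simp only [Finset.sum_boole, G.neighborFinset_eq_filter, Finset.filter_filter]
  congr 2
  ext u
  simp [G.adj_comm, and_comm]

lemma sum_adj_eq_degree (v : V) : ∑ y, (if G.Adj v y then (1 : ℝ) else 0) = G.degree v := by
  rw [Finset.sum_boole, ← G.card_neighborFinset_eq_degree, G.neighborFinset_eq_filter]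

lemma two_div_mul_le {d D t : ℝ} (hd : 0 ≤ d) (hD : 0 ≤ D) (h : t ≤ d * D) :
    2 / d * t ≤ 2 * D := by
  rcases hd.eq_or_lt with rfl | hd
  · simpa using hD
  · rw [div_mul_eq_mul_div, div_le_iff₀ hd]
    linarith

lemma sum_sum_ite_adj (v : V) :
    ∑ x, ∑ y, (if G.Adj v x ∧ G.Adj v y then (1 : ℝ) else 0) = G.degree v * G.degree v := by
  rw [← sum_adj_eq_degree, Finset.sum_mul_sum]
  refine Finset.sum_congr rfl fun x _ => Finset.sum_congr rfl fun y _ => ?_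
  by_cases h : G.Adj v x <;> by_cases h' : G.Adj v y <;> simp [h, h']

lemma sum_conflictWeight_le (v : V) :
    ∑ x, ∑ y, conflictWeight G v x y ≤ 4 * G.maxDegree := by
  have hd : (G.degree v : ℝ) ≤ G.maxDegree := by exact_mod_cast G.degree_le_maxDegree v
  have h : ∑ x, ∑ y, conflictWeight G v x y = 2 / (G.degree v : ℝ) *
      ((∑ y, if G.degree y ≤ G.degree v then
        ∑ u ∈ G.neighborFinset v, (if G.Adj u y then (1 : ℝ) else 0) else 0) +
        G.degree v * G.degree v) := by
    simp only [conflictWeight, ← Finset.mul_sum, Finset.sum_add_distrib, sum_sum_ite_adj]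
    congr 2
    simp only [ite_and]
    rw [Finset.sum_eq_single v]
    · simp
    · intro x _ hx
      simp [hx]
    · simp
  have h1 : (∑ y, if G.degree y ≤ G.degree v then
      ∑ u ∈ G.neighborFinset v, (if G.Adj u y then (1 : ℝ) else 0) else 0) ≤
      G.degree v * G.maxDegree := by
    refine le_trans (Finset.sum_le_sum fun y _ => ?_) (sum_codegree_le G v)
    split_ifs
    · exact le_rfl
    · positivity
  rw [h]
  refine (two_div_mul_le (Nat.cast_nonneg _) (D := 2 * G.maxDegree) (by positivity) ?_).trans
    (by linarith)
  nlinarith [mul_le_mul_of_nonneg_left hd (Nat.cast_nonneg (G.degree v))]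

lemma sum_conflictWeight_through_le (x : V) :
    ∑ v, ∑ y, (conflictWeight G v x y + conflictWeight G v y x) ≤ 8 * G.maxDegree := by
  have hd : (G.degree x : ℝ) ≤ G.maxDegree := by exact_mod_cast G.degree_le_maxDegree x
  set e : V → V → ℝ := fun v y => ∑ u ∈ G.neighborFinset v, (if G.Adj u y then (1 : ℝ) else 0)
    with he
  have he0 : ∀ v y, 0 ≤ e v y := fun v y => by positivity
  have hsplit : ∑ v, ∑ y, (conflictWeight G v x y + conflictWeight G v y x) =
      (∑ v, ∑ y, 2 / (G.degree v : ℝ) * (if x = v ∧ G.degree y ≤ G.degree v then e v y else 0)) +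
      (∑ v, ∑ y, 2 / (G.degree v : ℝ) * (if y = v ∧ G.degree x ≤ G.degree v then e v x else 0)) +
      2 * ∑ v, ∑ y, 2 / (G.degree v : ℝ) * (if G.Adj v x ∧ G.Adj v y then 1 else 0) := by
    simp only [Finset.mul_sum, ← Finset.sum_add_distrib]
    refine Finset.sum_congr rfl fun v _ => Finset.sum_congr rfl fun y _ => ?_
    simp only [conflictWeight, he, and_comm (a := G.Adj v y)]
    ring
  have h1 : (∑ v, ∑ y, 2 / (G.degree v : ℝ) *
      (if x = v ∧ G.degree y ≤ G.degree v then e v y else 0)) ≤ 2 * G.maxDegree := by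
    rw [Finset.sum_eq_single x (fun v _ hv => by simp [hv.symm]) (by simp), ← Finset.mul_sum]
    refine two_div_mul_le (Nat.cast_nonneg _) (Nat.cast_nonneg _)
      (le_trans (Finset.sum_le_sum fun y _ => ?_) (sum_codegree_le G x))
    split_ifs
    exacts [le_rfl, he0 x y]
  -- Here `x` is the competitor of `v`. The condition `G.degree x ≤ G.degree v` allows `2 / G.degree
  -- v` to be replaced by `2 / G.degree x`, after which the codegrees are summed from `x`.
  have h2 : (∑ v, ∑ y, 2 / (G.degree v : ℝ) *
      (if y = v ∧ G.degree x ≤ G.degree v then e v x else 0)) ≤ 2 * G.maxDegree := by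
    have hle : ∀ v, ∑ y, 2 / (G.degree v : ℝ) *
        (if y = v ∧ G.degree x ≤ G.degree v then e v x else 0) ≤
        2 / (G.degree x : ℝ) * e x v := by
      intro v
      rw [Finset.sum_eq_single v (fun y _ hy => by simp [hy]) (by simp)]
      have hcomm : e v x = e x v := codegree_comm G v x
      by_cases hx : G.degree x = 0
      · have : e x v = 0 := by
          have hN : G.neighborFinset x = ∅ := by
            rwa [← Finset.card_eq_zero, G.card_neighborFinset_eq_degree]
          simp [he, hN]
        simp [hcomm, this]
      · split_ifs with h
        · rw [hcomm]
          have hx' : (0 : ℝ) < G.degree x := by exact_mod_cast Nat.pos_of_ne_zero hx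
          have hxv : (G.degree x : ℝ) ≤ G.degree v := by exact_mod_cast h.2
          exact mul_le_mul_of_nonneg_right (div_le_div_of_nonneg_left zero_le_two hx' hxv)
            (he0 x v)
        · have := he0 x v
          simp only [mul_zero]
          positivity
    refine (Finset.sum_le_sum fun v _ => hle v).trans ?_
    rw [← Finset.mul_sum]
    exact two_div_mul_le (Nat.cast_nonneg _) (Nat.cast_nonneg _) (sum_codegree_le G x)
  have h3 : ∑ v, ∑ y, 2 / (G.degree v : ℝ) * (if G.Adj v x ∧ G.Adj v y then 1 else 0) ≤
      2 * G.maxDegree := by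
    have hle : ∀ v, ∑ y, 2 / (G.degree v : ℝ) * (if G.Adj v x ∧ G.Adj v y then 1 else 0) ≤
        2 * (if G.Adj x v then 1 else 0) := by
      intro v
      by_cases h : G.Adj v x
      · simp only [h, true_and, ← Finset.mul_sum, sum_adj_eq_degree, h.symm, if_true]
        exact two_div_mul_le (Nat.cast_nonneg _) zero_le_one (by simp)
      · simp [h, G.adj_comm x v]
    refine (Finset.sum_le_sum fun v _ => hle v).trans ?_
    rw [← Finset.mul_sum, sum_adj_eq_degree]
    linarith
  rw [hsplit]
  linarith

/-- Each lost edge `vu` has a witness: a competitor of `v` at `u` of no larger degree, or another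
neighbour of `v` with the colour of `u`. The factor `2 / G.degree v` turns weight below `1` into
fewer than half of the edges lost. -/
lemma card_rejected_le {C : Type*} (f : V → C) (v : V) :
    2 / (G.degree v : ℝ) * #{u ∈ G.neighborFinset v | ¬ (mutualGraph G f).Adj v u} ≤
      monoWeight (conflictWeight G v) univ f := by
  set e : V → ℝ := fun y => ∑ u ∈ G.neighborFinset v, (if G.Adj u y then (1 : ℝ) else 0)
    with he
  have hsplit : monoWeight (conflictWeight G v) univ f = 2 / (G.degree v : ℝ) *
      ∑ u ∈ G.neighborFinset v,
        ((∑ y, if (v ≠ y ∧ f v = f y ∧ G.degree y ≤ G.degree v) ∧ G.Adj u y then (1 : ℝ) else 0) +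
        ∑ y, if (u ≠ y ∧ f u = f y) ∧ G.Adj v y then (1 : ℝ) else 0) := by
    have h1 : ∑ u ∈ G.neighborFinset v,
        (∑ y, if (v ≠ y ∧ f v = f y ∧ G.degree y ≤ G.degree v) ∧ G.Adj u y then (1 : ℝ) else 0) =
        ∑ x, ∑ y, if x ≠ y ∧ f x = f y then
          (if x = v ∧ G.degree y ≤ G.degree v then e y else 0) else 0 := by
      rw [Finset.sum_comm]
      refine Eq.trans ?_ (Finset.sum_eq_single v ?_ ?_).symm
      · refine Finset.sum_congr rfl fun y _ => ?_
        by_cases h : v ≠ y ∧ f v = f y ∧ G.degree y ≤ G.degree v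
        · simp [h, he]
        · have h' : ¬ ((v ≠ y ∧ f v = f y) ∧ G.degree y ≤ G.degree v) := by tauto
          simp only [h, false_and, if_false, Finset.sum_const_zero, true_and]
          rw [← ite_and, if_neg h']
      · intro x _ hx
        simp [hx]
      · simp
    have h2 : ∑ u ∈ G.neighborFinset v,
        (∑ y, if (u ≠ y ∧ f u = f y) ∧ G.Adj v y then (1 : ℝ) else 0) =
        ∑ x, ∑ y, if x ≠ y ∧ f x = f y then
          (if G.Adj v x ∧ G.Adj v y then 1 else 0) else 0 := by
      rw [G.neighborFinset_eq_filter, Finset.sum_filter]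
      refine Finset.sum_congr rfl fun x _ => ?_
      by_cases h : G.Adj v x
      · simp [h, ite_and]
      · simp [h]
    rw [Finset.sum_add_distrib, h1, h2, ← Finset.sum_add_distrib, Finset.mul_sum]
    refine Finset.sum_congr rfl fun x _ => ?_
    rw [← Finset.sum_add_distrib, Finset.mul_sum]
    refine Finset.sum_congr rfl fun y _ => ?_
    by_cases h : x ≠ y ∧ f x = f y
    · simp only [if_pos h, conflictWeight, he]
    · simp only [if_neg h, add_zero, mul_zero]
  rw [hsplit, Finset.card_filter]
  push_cast
  refine mul_le_mul_of_nonneg_left (Finset.sum_le_sum fun u hu => ?_) (by positivity)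
  have hvu : G.Adj v u := by simpa using hu
  have n1 : 0 ≤ ∑ y, if (v ≠ y ∧ f v = f y ∧ G.degree y ≤ G.degree v) ∧ G.Adj u y
    then (1 : ℝ) else 0 := by positivity
  have n2 : 0 ≤ ∑ y, if (u ≠ y ∧ f u = f y) ∧ G.Adj v y then (1 : ℝ) else 0 := by positivity
  split_ifs with h
  · exact add_nonneg n1 n2
  · have h' : ¬ Accepts G f u v ∨ ¬ Accepts G f v u := by
      by_contra! hc
      exact h ⟨hvu, hc.2, hc.1⟩
    rcases h' with h' | h' <;> simp only [Accepts, not_forall, not_lt] at h'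
    · obtain ⟨w, hw, hne, hf, hdeg⟩ := h'
      have := Finset.single_le_sum (f := fun y =>
        if (v ≠ y ∧ f v = f y ∧ G.degree y ≤ G.degree v) ∧ G.Adj u y then (1 : ℝ) else 0)
        (fun y _ => by positivity) (Finset.mem_univ w)
      rw [if_pos ⟨⟨hne.symm, hf.symm, hdeg⟩, hw⟩] at this
      exact this.trans (le_add_of_nonneg_right n2)
    · obtain ⟨w, hw, hne, hf, hdeg⟩ := h'
      have := Finset.single_le_sum (f := fun y =>
        if (u ≠ y ∧ f u = f y) ∧ G.Adj v y then (1 : ℝ) else 0)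
        (fun y _ => by positivity) (Finset.mem_univ w)
      rw [if_pos ⟨⟨hne.symm, hf.symm⟩, hw⟩] at this
      exact this.trans (le_add_of_nonneg_left n1)

/-- Otherwise each of `v`, `w` would have strictly larger degree than the other. -/
lemma mutualGraph_eq_of_color_eq {C : Type*} {f : V → C} {u v w : V}
    (hv : (mutualGraph G f).Adj u v) (hw : (mutualGraph G f).Adj u w) (h : f v = f w) : v = w := by
  by_contra hne
  exact lt_asymm (hv.2.1 w hw.1 (Ne.symm hne) h.symm) (hw.2.1 v hv.1 hne h)

/-- With at least `32 Δ` colours, some colouring keeps half of the edges at every vertex. -/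
theorem exists_coloring_half_degree_le {C : Type*} [Fintype C] [Nonempty C]
    (hC : 32 * G.maxDegree ≤ Fintype.card C) :
    ∃ f : V → C, ∀ v, (G.degree v : ℝ) / 2 ≤
      #{u ∈ G.neighborFinset v | (mutualGraph G f).Adj v u} := by
  have hC' : (32 : ℝ) * G.maxDegree ≤ Fintype.card C := by exact_mod_cast hC
  have hm : (0 : ℝ) ≤ G.maxDegree := Nat.cast_nonneg _
  -- The constant `32` is `4 * 8`, from the per-vertex bound `8 Δ ≤ |C| / 4`.
  obtain ⟨f, hf⟩ := exists_coloring_monoWeight_lt_one (C := C) (conflictWeight_nonneg G)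
    (fun v => (sum_conflictWeight_le G v).trans (by linarith))
    (fun x => (sum_conflictWeight_through_le G x).trans (by linarith))
  refine ⟨f, fun v => ?_⟩
  have hrej := (card_rejected_le G f v).trans_lt (hf v)
  have hcard := Finset.card_filter_add_card_filter_not (s := G.neighborFinset v)
    (fun u => (mutualGraph G f).Adj v u)
  rw [G.card_neighborFinset_eq_degree] at hcard
  have hcard' : (#{u ∈ G.neighborFinset v | (mutualGraph G f).Adj v u} : ℝ) +
    #{u ∈ G.neighborFinset v | ¬ (mutualGraph G f).Adj v u} = G.degree v := by exact_mod_cast hcard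
  rcases (Nat.cast_nonneg (α := ℝ) (G.degree v)).eq_or_lt with h0 | h0
  · rw [← h0]
    simp
  · rw [div_mul_eq_mul_div, div_lt_one h0] at hrej
    linarith

end ConflictWeight

/-! ### Splitting into `C_4`-free classes -/

section PlaneClasses

variable {V K : Type*} [Field K]

/-- The subgraph of `H` formed by the edges whose colours `(a, b)`, `(c, d)` satisfy
`a c - b - d = m`. -/
def planeClass (H : SimpleGraph V) (f : V → K × K) (m : K) : SimpleGraph V where
  Adj u v := H.Adj u v ∧ (f u).1 * (f v).1 - (f u).2 - (f v).2 = m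
  symm := ⟨fun u v h => ⟨h.1.symm, by rw [← h.2]; ring⟩⟩
  loopless := ⟨fun _ h => h.1.ne rfl⟩

lemma planeClass_free {H : SimpleGraph V} {f : V → K × K}
    (hf : ∀ u v w, H.Adj u v → H.Adj u w → f v = f w → v = w) (m : K) :
    (SimpleGraph.cycleGraph 4).Free (planeClass H f m) := by
  rintro ⟨φ⟩
  have key : ∀ i j : Fin 4, (SimpleGraph.cycleGraph 4).Adj i j →
      (planeClass H f m).Adj (φ i) (φ j) := fun i j h => φ.toHom.map_adj h
  obtain ⟨h01, e01⟩ := key 0 1 (by decide)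
  obtain ⟨h12, e12⟩ := key 1 2 (by decide)
  obtain ⟨h23, e23⟩ := key 2 3 (by decide)
  obtain ⟨h30, e30⟩ := key 3 0 (by decide)
  have n02 : φ 0 ≠ φ 2 := fun h => absurd (φ.injective h) (by decide)
  have n13 : φ 1 ≠ φ 3 := fun h => absurd (φ.injective h) (by decide)
  -- The alternating sum of the four edge equations cancels `m` and all second coordinates. Once one
  -- factor vanishes, two opposite vertices share a colour and a common neighbour.
  have hprod : ((f (φ 0)).1 - (f (φ 2)).1) * ((f (φ 1)).1 - (f (φ 3)).1) = 0 := by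
    linear_combination e01 - e12 + e23 - e30
  rcases mul_eq_zero.1 hprod with h | h
  · refine n02 (hf _ _ _ h01.symm h12 (Prod.ext (sub_eq_zero.1 h) ?_))
    linear_combination (f (φ 1)).1 * h - e01 + e12
  · refine n13 (hf _ _ _ h12.symm h23 (Prod.ext (sub_eq_zero.1 h) ?_))
    linear_combination (f (φ 2)).1 * h - e12 + e23

end PlaneClasses

/-! ### Choice of the prime and assembly -/

theorem corollary3 :
    ∃ Δ₀ : ℕ, ∀ α : ℝ, 16 < α → ∃ β : ℝ, 0 < β ∧
      ∀ (V : Type*) [Fintype V] (G : SimpleGraph V) [DecidableRel G.Adj],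
        Δ₀ ≤ G.maxDegree →
        (Real.log (G.maxDegree : ℝ)) ^ 2 ≤ (G.minDegree : ℝ) →
        ∃ ℓ : ℕ, ℓ ≤ ⌈2 * Real.sqrt (2 * (⌈α * (G.maxDegree : ℝ)⌉₊ : ℝ))⌉₊ ∧
          ∃ S : Fin ℓ → SimpleGraph V,
            (∀ i, S i ≤ G) ∧
            (∀ i, (SimpleGraph.cycleGraph 4).Free (S i)) ∧
            (∀ i j, i ≠ j → Disjoint (S i).edgeSet (S j).edgeSet) ∧
            ∀ v : V, β * (G.degree v : ℝ) ≤ ∑ i : Fin ℓ, ((S i).degree v : ℝ) := by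
  -- `Δ ≥ 1` makes `M` positive, as Bertrand's postulate needs below.
  refine ⟨1, fun α hα => ⟨1 / 2, by norm_num, fun V _ G _ hΔ _ => ?_⟩⟩
  set M := ⌈α * (G.maxDegree : ℝ)⌉₊ with hM
  have hMge : 16 * G.maxDegree ≤ M := by
    have h1 : (16 : ℝ) * G.maxDegree ≤ α * G.maxDegree :=
      mul_le_mul_of_nonneg_right hα.le (Nat.cast_nonneg _)
    exact_mod_cast h1.trans (Nat.le_ceil _)
  obtain ⟨q, hq, hlt, hle⟩ := Nat.exists_prime_lt_and_le_two_mul (Nat.sqrt (2 * M))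
    (Nat.sqrt_pos.2 (by omega)).ne'
  have : Fact q.Prime := ⟨hq⟩
  have hqM : 2 * M < q * q := Nat.sqrt_lt.1 hlt
  obtain ⟨f, hf⟩ := exists_coloring_half_degree_le (C := ZMod q × ZMod q) G (by
    rw [Fintype.card_prod, ZMod.card]
    omega)
  have hinj : ∀ i j : Fin q, ((i : ℕ) : ZMod q) = ((j : ℕ) : ZMod q) → i = j := fun i j h => by
    rw [ZMod.natCast_eq_natCast_iff'] at h
    rw [Nat.mod_eq_of_lt i.2, Nat.mod_eq_of_lt j.2] at h
    exact Fin.ext h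
  refine ⟨q, ?_, fun i => planeClass (mutualGraph G f) f ((i : ℕ) : ZMod q),
    fun i u v h => h.1.1, fun i => planeClass_free
      (fun u v w hv hw h => mutualGraph_eq_of_color_eq G hv hw h) _, fun i j hij => ?_,
    fun v => ?_⟩
  · have h1 : (q : ℝ) ≤ 2 * Real.sqrt (2 * (M : ℝ)) := by
      have h2 : ((Nat.sqrt (2 * M) : ℕ) : ℝ) ≤ Real.sqrt ((2 * M : ℕ) : ℝ) :=
        Real.nat_sqrt_le_real_sqrt
      have h3 : (q : ℝ) ≤ 2 * (Nat.sqrt (2 * M) : ℕ) := by exact_mod_cast hle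
      push_cast at h2
      linarith
    exact_mod_cast h1.trans (Nat.le_ceil _)
  · rw [SimpleGraph.disjoint_edgeSet, disjoint_iff]
    ext u v
    simp only [SimpleGraph.inf_adj, SimpleGraph.bot_adj, iff_false, not_and]
    exact fun h h' => hij (hinj i j (h.2.symm.trans h'.2))
  -- Each kept edge at `v` takes exactly one value of `m`, so the class degrees sum to the degree in
  -- `mutualGraph G f`.
  · have hsum : ∑ i : Fin q, (planeClass (mutualGraph G f) f ((i : ℕ) : ZMod q)).degree v =
        #{u ∈ G.neighborFinset v | (mutualGraph G f).Adj v u} := by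
      rw [Finset.card_eq_sum_card_fiberwise (t := univ) (f := fun u =>
        (⟨((f v).1 * (f u).1 - (f v).2 - (f u).2).val, ZMod.val_lt _⟩ : Fin q))
        (fun _ _ => by simp)]
      refine Finset.sum_congr rfl fun i _ => ?_
      rw [← SimpleGraph.card_neighborFinset_eq_degree]
      congr 1
      ext u
      rw [SimpleGraph.mem_neighborFinset, Finset.mem_filter, Finset.mem_filter,
        SimpleGraph.mem_neighborFinset]
      constructor
      · rintro ⟨h, e⟩
        refine ⟨⟨h.1, h⟩, Fin.ext ?_⟩
        simpa only [e] using ZMod.val_cast_of_lt i.2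
      · rintro ⟨⟨-, h⟩, e⟩
        refine ⟨h, ?_⟩
        rw [← e]
        simp
    have := hf v
    rw [← hsum] at this
    push_cast at this
    linarith
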